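/- **Setting.** Labels are $\pm1$. A randomized online learner $\mathcal W$ has an internal state. On input $x$ it outputs a label $\mathcal W(x)\in\{\pm1\}$, which depends on its state and on fresh internal randomness. Its state changes only when it is fed a labelled example $(x,y)$. Let $\mathcal H\subseteq\{\pm1\}^{\mathcal X}$ and $\gamma>0$. A sequence $(x_1,y_1),\dots,(x_n,y_n)$ is realizable by $\mathcal H$ if some $h\in\mathcal H$ satisfies $h(x_t)=y_t$ for all $t\le n$. The learner $\mathcal W$ is a $(\gamma,T)$-weak online learner for $\mathcal H$ with regret $R_{\mathcal W}:\mathbb N\to\mathbb R_{\ge0}$ (a non-decreasing, sub-linear function) if for every $n\le T$ and every sequence $(x_1,y_1),\dots,(x_n,y_n)$ realizable by $\mathcal H$, when $\mathcal W$ predicts on and is then fed each of these examples in turn, $$\sum_{t=1}^n\mathbb E[\mathcal W(x_t)]\,y_t\ \ge\ \gamma n-R_{\mathcal W}(n).$$ An online convex optimizer (OCO) $\mathcal A$ over $[0,1]$ chooses a first decision $p^1$, and then $p^i=\mathcal A(\ell^1,\dots,\ell^{i-1})\in[0,1]$ for $i>1$. Its regret is $\sum_{i=1}^N\ell^i(p^i)-\min_{p\in[0,1]}\sum_{i=1}^N\ell^i(p)$.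 For $z\in\mathbb R$, let $\Pi(z)$ be the random label that equals $\mathrm{sign}(z)$ if $|z|\ge1$, and otherwise equals $+1$ with probability $\frac{1+z}2$ and $-1$ with probability $\frac{1-z}2$. **Algorithm.** Given weak learners $\mathcal W_1,\dots,\mathcal W_N$ with independent internal randomness and an OCO $\mathcal A$ over $[0,1]$, in each round $t=1,\dots,T$: 1. Get $x_t$ and predict $\hat y_t=\Pi\big(\frac1{\gamma N}\sum_{i=1}^N\mathcal W_i(x_t)\big)$; then observe $y_t$. 2. For $i=1,\dots,N$: set $p_t^1=\frac12$ if $i=1$, and $p_t^i=\mathcal A(\ell_t^1,\dots,\ell_t^{i-1})$ if $i>1$; set $\ell_t^i(p)=p\big(\frac1\gamma\mathcal W_i(x_t)y_t-1\big)$; and feed $(x_t,y_t)$ to $\mathcal W_i$ with probability $p_t^i$ (otherwise $\mathcal W_i$ keeps its state). **Theorem.** There is a function $g:\mathbb N\to\mathbb R_{\ge0}$ with $g(T)=\tilde O(\sqrt T)$, that is, $g(T)=O(\sqrt T\,\log^kT)$ for some $k$, such that the following holds with $\tilde R_{\mathcal W}(T):=2R_{\mathcal W}(T)+g(T)$. Let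 $T,N\ge1$, let $\mathcal W_1,\dots,\mathcal W_N$ be $(\gamma,T)$-weak online learners for $\mathcal H$ with regret $R_{\mathcal W}$, and let $R_{\mathcal A}(N)$ be an upper bound on the regret of $\mathcal A$, with first decision $p^1=\frac12$, on all sequences of $N$ losses of the form $p\mapsto p(\frac1\gamma wy-1)$ with $w,y\in\{\pm1\}$. Then for every fixed sequence $(x_1,y_1),\dots,(x_T,y_T)$ realizable by $\mathcal H$, the predictions of the algorithm satisfy $$\frac1T\sum_{t=1}^T\mathbb E[\hat y_ty_t]\ \ge\ 1-\left(\frac{\tilde R_{\mathcal W}(T)}{\gamma T}+\frac{R_{\mathcal A}(N)}N\right),$$ where the expectation is over the randomness of the algorithm and of the weak learners. -/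

import Mathlib

open MeasureTheory

universe u v w

noncomputable section

namespace OnlineBoosting

/-! Labels are the elements of `ℤˣ = {1, -1}`. -/

/-- A randomized online learning algorithm for binary prediction on the domain `X`. It has an
internal state, drawn initially from `initLaw`. In each round it may use a fresh independent random
seed with law `noiseLaw`. Its prediction on `x` is a function of the state, `x` and the seed, and
when it is fed a labelled example `(x, y)` the state is updated (the same seed is available to the
update, so that the update may depend on the prediction that has been made). -/
structure OnlineLearner (X : Type u) where
  State : Type v
  Noise : Type w
  [measState : MeasurableSpace State]
  [measNoise : MeasurableSpace Noise]
  initLaw : Measure State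
  noiseLaw : Measure Noise
  [probInit : IsProbabilityMeasure initLaw]
  [probNoise : IsProbabilityMeasure noiseLaw]
  predict : State → X → Noise → ℤˣ
  update : State → X → ℤˣ → Noise → State
  measurable_predict : ∀ x : X, Measurable fun q : State × Noise => predict q.1 x q.2
  measurable_update : ∀ (x : X) (y : ℤˣ), Measurable fun q : State × Noise => update q.1 x y q.2

attribute [instance] OnlineLearner.measState OnlineLearner.measNoise
  OnlineLearner.probInit OnlineLearner.probNoise

/-- The randomness of a learner: its initial state and its seed for each round. -/
abbrev OnlineLearner.Tape {X : Type*} (W : OnlineLearner X) : Type _ :=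
  W.State × (ℕ → W.Noise)

/-- The law of the tape: all its components are independent. -/
def OnlineLearner.tapeLaw {X : Type*} (W : OnlineLearner X) : Measure W.Tape :=
  W.initLaw.prod (Measure.infinitePi fun _ : ℕ => W.noiseLaw)

/-- The internal state at the start of round `t` (rounds are numbered `0, 1, 2, …`), when the
learner runs on the tape `τ` and is fed `(x 0, y 0), (x 1, y 1), …`. -/
def OnlineLearner.stateAt {X : Type*} (W : OnlineLearner X) (x : ℕ → X) (y : ℕ → ℤˣ)
    (τ : W.Tape) : ℕ → W.State
  | 0 => τ.1
  | t + 1 => W.update (W.stateAt x y τ t) (x t) (y t) (τ.2 t)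

/-- The prediction on `x t` in round `t` of the same run. -/
def OnlineLearner.predictionAt {X : Type*} (W : OnlineLearner X) (x : ℕ → X) (y : ℕ → ℤˣ)
    (τ : W.Tape) (t : ℕ) : ℤˣ :=
  W.predict (W.stateAt x y τ t) (x t) (τ.2 t)

/-- The first `n` examples of the sequence are realizable by the class `H`. -/
def Realizable {X : Type*} (H : Set (X → ℤˣ)) (n : ℕ) (x : ℕ → X) (y : ℕ → ℤˣ) : Prop :=
  ∃ h ∈ H, ∀ t < n, h (x t) = y t

/-- An additive regret function: nonnegative, non-decreasing and sub-linear. -/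
structure IsRegretFunction (R : ℕ → ℝ) : Prop where
  nonneg : ∀ n, 0 ≤ R n
  mono : Monotone R
  sublinear : R =o[Filter.atTop] fun n : ℕ => (n : ℝ)

/-- `W` is a weak online learner for `H` with advantage `γ`, horizon `T` and regret function `R`:
on every realizable sequence of length `n ≤ T` its expected gain is at least `γ n - R n`. -/
structure IsWeakOnlineLearner {X : Type*} (H : Set (X → ℤˣ)) (γ : ℝ) (T : ℕ) (R : ℕ → ℝ)
    (W : OnlineLearner X) : Prop where
  regret : IsRegretFunction R
  gain : ∀ n ≤ T, ∀ (x : ℕ → X) (y : ℕ → ℤˣ), Realizable H n x y →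
    γ * n - R n ≤
      ∑ t ∈ Finset.range n,
        (∫ τ, ((W.predictionAt x y τ t : ℤ) : ℝ) ∂W.tapeLaw) * ((y t : ℤ) : ℝ)

/-- An online convex optimization algorithm with decision set `K ⊆ ℝ`: it maps the losses revealed
so far to the next decision. -/
abbrev OCOAlgorithm (K : Set ℝ) : Type := List (ℝ → ℝ) → K

/-- The decisions of `A` on the losses `ℓ 0, …, ℓ (N - 1)` with first decision `p₁`; every later
decision is computed by `A` from the preceding losses. -/
def ocoPlay {K : Set ℝ} (A : OCOAlgorithm K) (p₁ : K) {N : ℕ} (ℓ : Fin N → ℝ → ℝ) (i : Fin N) : K :=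
  if (i : ℕ) = 0 then p₁
  else A (List.ofFn fun j : Fin (i : ℕ) => ℓ (Fin.castLE i.isLt.le j))

/-- The regret of `A` on a sequence of `N` losses. -/
def ocoRegret {K : Set ℝ} (A : OCOAlgorithm K) (p₁ : K) {N : ℕ} (ℓ : Fin N → ℝ → ℝ) : ℝ :=
  ∑ i, ℓ i (ocoPlay A p₁ ℓ i) - ⨅ p : K, ∑ i, ℓ i p

/-- `R` bounds the regret of `A` over `N` rounds with losses from the family `F`. -/
def IsOCORegretBound {K : Set ℝ} (A : OCOAlgorithm K) (p₁ : K) (F : Set (ℝ → ℝ)) (N : ℕ)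
    (R : ℝ) : Prop :=
  ∀ ℓ : Fin N → ℝ → ℝ, (∀ i, ℓ i ∈ F) → ocoRegret A p₁ ℓ ≤ R

/-- The loss `p ↦ p (w y / γ - 1)` for a weak prediction `w` and a label `y`. -/
def boosterLoss (γ : ℝ) (w y : ℤˣ) : ℝ → ℝ :=
  fun p => p * (1 / γ * ((w : ℤ) : ℝ) * ((y : ℤ) : ℝ) - 1)

/-- The family of all losses that the booster can hand to the optimizer. -/
def boosterLosses (γ : ℝ) : Set (ℝ → ℝ) :=
  {f | ∃ w y : ℤˣ, f = boosterLoss γ w y}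

/-- The randomized projection of `z` to a label, with a uniform random `u`: it is `sign z` if
`1 ≤ |z|`, and otherwise `1` with probability `(1 + z) / 2` and `-1` with probability
`(1 - z) / 2`. -/
def randomProj (z : ℝ) (u : unitInterval) : ℤˣ :=
  if 1 ≤ |z| then (if 0 < z then 1 else -1)
  else if (u : ℝ) < (1 + z) / 2 then 1 else -1

/-- The first decision `1 / 2`. -/
def half : unitInterval := ⟨1 / 2, by norm_num, by norm_num⟩

section Booster

variable {X : Type*} {N : ℕ} (W : Fin N → OnlineLearner X) (γ : ℝ)
  (A : OCOAlgorithm unitInterval) (x : ℕ → X) (y : ℕ → ℤˣ)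

/-- The randomness of the booster: the tapes of the weak learners, for each round and each weak
learner a uniform random number that decides whether the example is passed, and for each round a
uniform random number for the randomized projection. -/
abbrev BoosterSpace : Type _ :=
  (∀ i, (W i).Tape) × (ℕ → Fin N → unitInterval) × (ℕ → unitInterval)

/-- The law of the randomness of the booster: everything is independent. -/
def boosterLaw : Measure (BoosterSpace W) :=
  (Measure.pi fun i => (W i).tapeLaw).prod
    ((Measure.infinitePi fun _ : ℕ => Measure.pi fun _ : Fin N => (volume : Measure unitInterval)).prod
      (Measure.infinitePi fun _ : ℕ => (volume : Measure unitInterval)))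

/-- The predictions of the `N` weak learners on `x₀`, from the states `s` and the seeds `r`. -/
def weakPredictions (s : ∀ i, (W i).State) (x₀ : X) (r : ∀ i, (W i).Noise) (i : Fin N) : ℤˣ :=
  (W i).predict (s i) x₀ (r i)

/-- The optimizer's decision for the `i`-th weak learner in a round with weak predictions `w` and
label `y₀`. The first one is `1 / 2`, and each later one is computed by `A` from the losses of
the preceding weak learners in the same round. -/
def passProb (w : Fin N → ℤˣ) (y₀ : ℤˣ) (i : Fin N) : unitInterval :=
  ocoPlay A half (fun j => boosterLoss γ (w j) y₀) i

/-- The internal states of the weak learners at the start of round `t` of the booster. In each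
round, the example is passed to the `i`-th weak learner with probability `passProb`, and a weak
learner to which it is not passed keeps its state. -/
def boosterState (ω : BoosterSpace W) : ℕ → ∀ i, (W i).State
  | 0 => fun i => (ω.1 i).1
  | t + 1 => fun i =>
      if ω.2.1 t i <
          passProb γ A
            (weakPredictions W (boosterState ω t) (x t) fun j => (ω.1 j).2 t) (y t) i
      then (W i).update (boosterState ω t i) (x t) (y t) ((ω.1 i).2 t)
      else boosterState ω t i

/-- The predictions of the weak learners in round `t` of the booster. -/
def boosterWeak (ω : BoosterSpace W) (t : ℕ) : Fin N → ℤˣ :=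
  weakPredictions W (boosterState W γ A x y ω t) (x t) fun j => (ω.1 j).2 t

/-- The prediction of the booster in round `t`: the randomized projection of
`(1 / (γ N)) ∑ i, w i`, with `w i` the predictions of the weak learners. -/
def boosterPrediction (ω : BoosterSpace W) (t : ℕ) : ℤˣ :=
  randomProj (1 / (γ * N) * ∑ i, ((boosterWeak W γ A x y ω t i : ℤ) : ℝ)) (ω.2.2 t)

end Booster

/-- `g T = Õ(√T)`: up to a constant and a power of `log T`, `g T` is at most `√T`. -/
def IsSoftOSqrt (g : ℕ → ℝ) : Prop :=
  ∃ k : ℕ, g =O[Filter.atTop] fun T : ℕ => Real.sqrt T * Real.log T ^ k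

end OnlineBoosting

end

/-! Fix a round and put `z = (1 / (γ N)) ∑ i, w i * y`. The optimizer's losses are linear, so at a
constant decision `p` they sum to `p N (z - 1)`. Comparing with `p = 0` and `p = 1` bounds the
optimal loss by `N (clip z - 1)`, and `clip z` is the conditional expectation of the booster's gain
(`oco_round`). It remains to bound below, for each learner `i`, the expected sum over rounds of
`p_t^i (w_i y / γ - 1)`.

Two independence facts do this. The coin for passing is fresh, so `p_t^i` may be replaced by the
indicator of passing (`integral_ite_boosterPass`). And whether learner `i` receives an example
depends on the learners `j < i` and on coins, never on its own tape. With everything but that tape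
frozen, learner `i` runs on a deterministic, still realizable subsequence, where its guarantee costs
at most `R T` (`lazy_gain`, `passed_gain`). Everything holds exactly in expectation, so `g = 0`
works. Independence is expressed by resampling: replacing one coordinate by a fresh copy preserves
the law, so expectations may be computed after it. -/

namespace OnlineBoosting

/-! ### Resampling and reindexing of product measures -/

/-- Replacing one coordinate of an independent family by a fresh copy preserves its law. -/
theorem measurePreserving_update {ι : Type*} [DecidableEq ι] {α : ι → Type*}
    [∀ i, MeasurableSpace (α i)] (μ : ∀ i, Measure (α i)) [∀ i, IsProbabilityMeasure (μ i)]
    (i : ι) :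
    MeasurePreserving (fun p : (∀ j, α j) × α i => Function.update p.1 i p.2)
      ((Measure.infinitePi μ).prod (μ i)) (Measure.infinitePi μ) := by
  have hm : Measurable (fun p : (∀ j, α j) × α i => Function.update p.1 i p.2) := by
    refine measurable_pi_lambda _ fun j => ?_
    by_cases h : j = i
    · subst h
      simpa using measurable_snd
    · simpa [Function.update_of_ne h, Function.comp_def] using
        (measurable_pi_apply j).comp (measurable_fst (α := ∀ j, α j) (β := α i))
  refine ⟨hm, Measure.eq_infinitePi _ fun s t ht => ?_⟩
  rw [Measure.map_apply hm (.pi s.countable_toSet fun _ _ => ht _)]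
  by_cases hi : i ∈ s
  · have : (fun p : (∀ j, α j) × α i => Function.update p.1 i p.2) ⁻¹' (s : Set ι).pi t
        = ((s.erase i : Finset ι) : Set ι).pi t ×ˢ t i := by
      ext p
      simp only [Set.mem_preimage, Set.mem_pi, Set.mem_prod, Finset.mem_coe, Finset.mem_erase]
      constructor
      · intro h
        exact ⟨fun j hj => by simpa [Function.update_of_ne hj.1] using h j hj.2,
          by simpa using h i hi⟩
      · rintro ⟨h1, h2⟩ j hj
        by_cases hji : j = i
        · subst hji
          simpa using h2
        · simpa [Function.update_of_ne hji] using h1 j ⟨hji, hj⟩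
    rw [this, Measure.prod_prod, Measure.infinitePi_pi _ fun j _ => ht j,
      Finset.prod_erase_mul _ _ hi]
  · have : (fun p : (∀ j, α j) × α i => Function.update p.1 i p.2) ⁻¹' (s : Set ι).pi t
        = (s : Set ι).pi t ×ˢ Set.univ := by
      ext p
      simp only [Set.mem_preimage, Set.mem_pi, Set.mem_prod, Finset.mem_coe, Set.mem_univ,
        and_true]
      refine forall₂_congr fun j hj => ?_
      rw [Function.update_of_ne (ne_of_mem_of_not_mem hj hi)]
    rw [this, Measure.prod_prod, Measure.infinitePi_pi _ fun j _ => ht j, measure_univ, mul_one]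

/-- Reindexing an i.i.d. family along an injection preserves its law. -/
theorem measurePreserving_comp_injective {ι κ α : Type*} [MeasurableSpace α] (μ : Measure α)
    [IsProbabilityMeasure μ] {σ : κ → ι} (hσ : Function.Injective σ) :
    MeasurePreserving (fun f : ι → α => f ∘ σ)
      (Measure.infinitePi fun _ => μ) (Measure.infinitePi fun _ => μ) := by
  classical
  have hm : Measurable (fun f : ι → α => f ∘ σ) :=
    measurable_pi_lambda _ fun k => measurable_pi_apply (σ k)
  refine ⟨hm, Measure.eq_infinitePi _ fun s t ht => ?_⟩
  rw [Measure.map_apply hm (.pi s.countable_toSet fun _ _ => ht _)]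
  -- `Function.extend` transports the sides of the box along `σ`; its default value is never seen,
  -- since the new box is indexed by the image of `s`.
  have : (fun f : ι → α => f ∘ σ) ⁻¹' (s : Set κ).pi t
      = ((s.map ⟨σ, hσ⟩ : Finset ι) : Set ι).pi (Function.extend σ t fun _ => Set.univ) := by
    ext f
    simp [Set.mem_pi, hσ.extend_apply]
  rw [this, Measure.infinitePi_pi]
  · simp [hσ.extend_apply]
  · intro i hi
    obtain ⟨k, -, rfl⟩ := Finset.mem_map.1 hi
    simpa [hσ.extend_apply] using ht k

/-- With its companion for the second factor, this lifts resampling of one coordinate to the nested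
product `boosterLaw`. -/
theorem measurePreserving_resample_fst {α β γ : Type*} [MeasurableSpace α] [MeasurableSpace β]
    [MeasurableSpace γ] {μ : Measure α} {ν : Measure β} {κ : Measure γ} [SFinite μ] [SFinite ν]
    [SFinite κ] {φ : α × γ → α} (h : MeasurePreserving φ (μ.prod κ) μ) :
    MeasurePreserving (fun p : (α × β) × γ => (φ (p.1.1, p.2), p.1.2))
      ((μ.prod ν).prod κ) (μ.prod ν) := by
  have h1 : MeasurePreserving (MeasurableEquiv.prodAssoc : (α × β) × γ ≃ᵐ α × β × γ)
      ((μ.prod ν).prod κ) (μ.prod (ν.prod κ)) := measurePreserving_prodAssoc μ ν κ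
  have h2 : MeasurePreserving (Prod.map id Prod.swap : α × β × γ → α × γ × β)
      (μ.prod (ν.prod κ)) (μ.prod (κ.prod ν)) :=
    (MeasurePreserving.id μ).prod Measure.measurePreserving_swap
  have h3 : MeasurePreserving (MeasurableEquiv.prodAssoc.symm : α × γ × β ≃ᵐ (α × γ) × β)
      (μ.prod (κ.prod ν)) ((μ.prod κ).prod ν) := (measurePreserving_prodAssoc μ κ ν).symm _
  exact (h.prod (MeasurePreserving.id ν)).comp (h3.comp (h2.comp h1))

theorem measurePreserving_resample_snd {α β γ : Type*} [MeasurableSpace α] [MeasurableSpace β]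
    [MeasurableSpace γ] {μ : Measure α} {ν : Measure β} {κ : Measure γ} [SFinite μ] [SFinite ν]
    [SFinite κ] {φ : β × γ → β} (h : MeasurePreserving φ (ν.prod κ) ν) :
    MeasurePreserving (fun p : (α × β) × γ => (p.1.1, φ (p.1.2, p.2)))
      ((μ.prod ν).prod κ) (μ.prod ν) :=
  ((MeasurePreserving.id μ).prod h).comp (measurePreserving_prodAssoc μ ν κ)

/-- An expectation can be computed by resampling first. -/
theorem integral_resample {Ω S : Type*} [MeasurableSpace Ω] [MeasurableSpace S] {P : Measure Ω}
    {κ : Measure S} [SFinite P] [SFinite κ] {φ : Ω × S → Ω}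
    (h : MeasurePreserving φ (P.prod κ) P) {f : Ω → ℝ} (hf : Integrable f P) :
    Integrable (fun a => ∫ s, f (φ (a, s)) ∂κ) P ∧
      ∫ a, f a ∂P = ∫ a, ∫ s, f (φ (a, s)) ∂κ ∂P := by
  have hi : Integrable (fun p => f (φ p)) (P.prod κ) := h.integrable_comp_of_integrable hf
  refine ⟨hi.integral_prod_left, ?_⟩
  rw [← integral_prod _ hi, ← integral_map h.measurable.aemeasurable
    (by rw [h.map_eq]; exact hf.aestronglyMeasurable), h.map_eq]

instance : MeasurableSingletonClass ℤˣ :=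
  ⟨fun a => ⟨{(a : ℤ)}, MeasurableSet.of_discrete, by ext b; simp [Units.ext_iff]⟩⟩

theorem units_int_cast_eq_or (a : ℤˣ) : ((a : ℤ) : ℝ) = 1 ∨ ((a : ℤ) : ℝ) = -1 := by
  rcases Int.units_eq_one_or a with rfl | rfl <;> simp

theorem integrable_comp_of_finite {Ω S : Type*} [MeasurableSpace Ω] [MeasurableSpace S]
    [Finite S] [MeasurableSingletonClass S] {P : Measure Ω} [IsFiniteMeasure P] {g : Ω → S}
    (hg : Measurable g) (f : S → ℝ) : Integrable (fun a => f (g a)) P :=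
  Integrable.comp_measurable (f := g) (g := f) .of_finite hg

/-! ### A weak learner that receives a fixed subsequence -/

variable {X : Type*}

/-- The internal state at the start of round `t` of a learner that is fed only the examples of the
rounds in `b`. -/
def OnlineLearner.lazyState (W : OnlineLearner X) (x : ℕ → X) (y : ℕ → ℤˣ) (b : ℕ → Prop)
    [DecidablePred b] (τ : W.Tape) : ℕ → W.State
  | 0 => τ.1
  | t + 1 =>
      if b t then W.update (W.lazyState x y b τ t) (x t) (y t) (τ.2 t) else W.lazyState x y b τ t

/-- By round `t` exactly `Nat.count b t` examples have been absorbed, the `k`-th one in round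
`Nat.nth b k`. Seeds are indexed by rounds, so they are reindexed too. -/
theorem OnlineLearner.lazyState_eq_stateAt (W : OnlineLearner X) (x : ℕ → X) (y : ℕ → ℤˣ)
    (b : ℕ → Prop) [DecidablePred b] (τ : W.Tape) (t : ℕ) :
    W.lazyState x y b τ t =
      W.stateAt (x ∘ Nat.nth b) (y ∘ Nat.nth b) (τ.1, τ.2 ∘ Nat.nth b) (Nat.count b t) := by
  induction t with
  | zero => simp [lazyState, stateAt]
  | succ t ih =>
    by_cases h : b t
    · simp [lazyState, Nat.count_succ, h, stateAt, ih, Nat.nth_count h]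
    · simp [lazyState, Nat.count_succ, h, ih]

theorem sum_range_ite_count (b : ℕ → Prop) [DecidablePred b] (f : ℕ → ℝ) (T : ℕ) :
    ∑ t ∈ Finset.range T, (if b t then f (Nat.count b t) else 0) =
      ∑ k ∈ Finset.range (Nat.count b T), f k := by
  induction T with
  | zero => simp
  | succ T ih =>
    by_cases h : b T <;> simp [Finset.sum_range_succ, Nat.count_succ, h, ih]

instance (W : OnlineLearner X) : IsProbabilityMeasure W.tapeLaw := by
  unfold OnlineLearner.tapeLaw
  infer_instance

theorem OnlineLearner.measurable_stateAt (W : OnlineLearner X) (x : ℕ → X) (y : ℕ → ℤˣ) (t : ℕ) :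
    Measurable fun τ => W.stateAt x y τ t := by
  induction t with
  | zero => exact measurable_fst
  | succ t ih =>
    exact (W.measurable_update (x t) (y t)).comp
      (ih.prodMk ((measurable_pi_apply t).comp measurable_snd))

theorem OnlineLearner.measurable_predictionAt (W : OnlineLearner X) (x : ℕ → X) (y : ℕ → ℤˣ)
    (t : ℕ) : Measurable fun τ => W.predictionAt x y τ t :=
  (W.measurable_predict (x t)).comp
    ((W.measurable_stateAt x y t).prodMk ((measurable_pi_apply t).comp measurable_snd))

/-- A weak learner keeps its guarantee on the subsequence that it is fed. -/
theorem IsWeakOnlineLearner.lazy_gain {H : Set (X → ℤˣ)} {γ : ℝ} {T : ℕ} {R : ℕ → ℝ}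
    {W : OnlineLearner X} (hW : IsWeakOnlineLearner H γ T R W) {x : ℕ → X} {y : ℕ → ℤˣ}
    (hxy : Realizable H T x y) (b : ℕ → Prop) [DecidablePred b] (hb : (Set.ofPred b).Infinite) :
    -R T ≤ ∫ τ, ∑ t ∈ Finset.range T, (if b t then
      ((W.predict (W.lazyState x y b τ t) (x t) (τ.2 t) : ℤ) : ℝ) * ((y t : ℤ) : ℝ) - γ else 0)
        ∂W.tapeLaw := by
  set x' := x ∘ Nat.nth b with hx'
  set y' := y ∘ Nat.nth b with hy'
  set n := Nat.count b T
  have hn : n ≤ T := Nat.count_le b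
  -- The seeds of the selected rounds are again i.i.d.; `b` must be infinite because otherwise
  -- `Nat.nth b` repeats its default value `0`.
  have hmp : MeasurePreserving (fun τ : W.Tape => ((τ.1, τ.2 ∘ Nat.nth b) : W.Tape))
      W.tapeLaw W.tapeLaw :=
    (MeasurePreserving.id W.initLaw).prod
      (measurePreserving_comp_injective W.noiseLaw (Nat.nth_injective hb))
  have hreal : Realizable H n x' y' := by
    obtain ⟨h, hH, hh⟩ := hxy
    refine ⟨h, hH, fun k hk => hh _ ?_⟩
    exact Nat.nth_lt_of_lt_count hk
  have hint : ∀ k, Integrable (fun τ => ((W.predictionAt x' y' τ k : ℤ) : ℝ)) W.tapeLaw := fun k =>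
    integrable_comp_of_finite (W.measurable_predictionAt x' y' k) fun a : ℤˣ => ((a : ℤ) : ℝ)
  have key : ∀ τ : W.Tape, ∑ t ∈ Finset.range T, (if b t then
      ((W.predict (W.lazyState x y b τ t) (x t) (τ.2 t) : ℤ) : ℝ) * ((y t : ℤ) : ℝ) - γ else 0)
      = ∑ k ∈ Finset.range n,
        (((W.predictionAt x' y' (τ.1, τ.2 ∘ Nat.nth b) k : ℤ) : ℝ) * ((y' k : ℤ) : ℝ) - γ) := by
    intro τ
    rw [← sum_range_ite_count b (fun k =>
      ((W.predictionAt x' y' (τ.1, τ.2 ∘ Nat.nth b) k : ℤ) : ℝ) * ((y' k : ℤ) : ℝ) - γ)]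
    refine Finset.sum_congr rfl fun t _ => ?_
    split_ifs with h
    · simp only [W.lazyState_eq_stateAt, OnlineLearner.predictionAt, hx', hy', Function.comp_apply,
        Nat.nth_count h]
    · rfl
  simp_rw [key]
  have hcomp : ∀ k, ∫ τ : W.Tape, ((W.predictionAt x' y' (τ.1, τ.2 ∘ Nat.nth b) k : ℤ) : ℝ)
      ∂W.tapeLaw = ∫ τ, ((W.predictionAt x' y' τ k : ℤ) : ℝ) ∂W.tapeLaw := by
    intro k
    conv_rhs => rw [← hmp.map_eq]
    rw [integral_map hmp.measurable.aemeasurable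
      (by rw [hmp.map_eq]; exact (hint k).aestronglyMeasurable)]
  have hint' : ∀ k, Integrable (fun τ : W.Tape =>
      ((W.predictionAt x' y' (τ.1, τ.2 ∘ Nat.nth b) k : ℤ) : ℝ)) W.tapeLaw := fun k =>
    hmp.integrable_comp_of_integrable (hint k)
  have hint'' : ∀ k ∈ Finset.range n, Integrable (fun τ : W.Tape =>
      ((W.predictionAt x' y' (τ.1, τ.2 ∘ Nat.nth b) k : ℤ) : ℝ) * ((y' k : ℤ) : ℝ) - γ)
      W.tapeLaw := fun k _ => ((hint' k).mul_const _).sub (integrable_const _)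
  rw [integral_finsetSum _ hint'']
  have : ∀ k, ∫ τ : W.Tape, (((W.predictionAt x' y' (τ.1, τ.2 ∘ Nat.nth b) k : ℤ) : ℝ)
        * ((y' k : ℤ) : ℝ) - γ) ∂W.tapeLaw
      = (∫ τ, ((W.predictionAt x' y' τ k : ℤ) : ℝ) ∂W.tapeLaw) * ((y' k : ℤ) : ℝ) - γ := by
    intro k
    rw [integral_sub ((hint' k).mul_const _) (integrable_const _), integral_mul_const, hcomp]
    simp
  simp_rw [this]
  rw [Finset.sum_sub_distrib]
  have := hW.gain n hn x' y' hreal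
  -- Monotonicity removes the dependence on the number `n` of examples fed.
  have := hW.regret.mono hn
  simp only [Finset.sum_const, Finset.card_range, nsmul_eq_mul]
  linarith


/-! ### Uniform random numbers -/

theorem integral_unitInterval_ite {q : ℝ} (h0 : 0 ≤ q) (h1 : q ≤ 1) (a b : ℝ) :
    ∫ u : unitInterval, (if (u : ℝ) < q then a else b) = q * a + (1 - q) * b := by
  have hs : MeasurableSet {u : unitInterval | (u : ℝ) < q} :=
    measurableSet_lt measurable_subtype_coe measurable_const
  have hv : (volume : Measure unitInterval).real {u : unitInterval | (u : ℝ) < q} = q := by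
    have : {u : unitInterval | (u : ℝ) < q} = Set.Iio (⟨q, h0, h1⟩ : unitInterval) := by
      ext u
      rfl
    rw [this, measureReal_def, unitInterval.volume_Iio, ENNReal.toReal_ofReal h0]
  have : (fun u : unitInterval => if (u : ℝ) < q then a else b)
      = fun u => Set.indicator {u : unitInterval | (u : ℝ) < q} (fun _ => a - b) u + b := by
    funext u
    by_cases h : (u : ℝ) < q <;> simp [h]
  rw [this, integral_add ((integrable_const _).indicator hs) (integrable_const _),
    integral_indicator_const _ hs, hv]
  simp
  ring

theorem integral_pi_unitInterval_ite {ι : Type*} [Fintype ι] (i : ι) (p : unitInterval) (a : ℝ) :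
    ∫ r : ι → unitInterval, (if r i < p then a else 0)
      ∂(Measure.pi fun _ => (volume : Measure unitInterval)) = p * a := by
  have hmp := measurePreserving_eval (fun _ : ι => (volume : Measure unitInterval)) i
  have hm : Measurable fun u : unitInterval => if (u : ℝ) < p then a else 0 :=
    Measurable.ite (measurableSet_lt measurable_subtype_coe measurable_const)
      measurable_const measurable_const
  have := integral_unitInterval_ite p.2.1 p.2.2 a 0
  rw [← hmp.map_eq, integral_map hmp.measurable.aemeasurable hm.aestronglyMeasurable] at this
  simpa using this

/-- The truncation of a real number to `[-1, 1]`. -/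
def clip (z : ℝ) : ℝ := max (-1) (min 1 z)

theorem integral_randomProj (z : ℝ) :
    ∫ u, ((randomProj z u : ℤ) : ℝ) = clip z := by
  by_cases h : 1 ≤ |z|
  · by_cases hz : 0 < z
    · have : 1 ≤ z := by rwa [abs_of_pos hz] at h
      simp [randomProj, h, hz, clip, this]
    · have : z ≤ -1 := by rw [abs_of_nonpos (not_lt.1 hz)] at h; linarith
      have h2 : min 1 z ≤ -1 := (min_le_right _ _).trans this
      simp [randomProj, h, hz, clip, h2]
  · have h' := abs_lt.1 (not_le.1 h)
    have : ∀ u, ((randomProj z u : ℤ) : ℝ) = if (u : ℝ) < (1 + z) / 2 then 1 else -1 := by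
      intro u
      simp only [randomProj, if_neg h]
      split_ifs <;> simp
    simp_rw [this]
    rw [integral_unitInterval_ite (by linarith) (by linarith), clip, min_eq_right h'.2.le,
      max_eq_right h'.1.le]
    ring

theorem measurable_randomProj : Measurable fun p : ℝ × unitInterval => randomProj p.1 p.2 := by
  unfold randomProj
  refine Measurable.ite (measurableSet_le measurable_const (by fun_prop))
    (Measurable.ite (measurableSet_lt measurable_const measurable_fst) measurable_const
      measurable_const)
    (Measurable.ite (measurableSet_lt (measurable_subtype_coe.comp measurable_snd)
      (by fun_prop)) measurable_const measurable_const)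

/-! ### The optimizer in one round -/

/-- Causality within a round: the optimizer sees only strictly earlier losses. This is why a
learner's own tape cannot influence what it is fed. -/
theorem passProb_congr {N : ℕ} (γ : ℝ) (A : OCOAlgorithm unitInterval) {w w' : Fin N → ℤˣ}
    (y₀ : ℤˣ) {i : Fin N} (h : ∀ j < i, w j = w' j) :
    passProb γ A w y₀ i = passProb γ A w' y₀ i := by
  unfold passProb ocoPlay
  have : (fun j : Fin (i : ℕ) => boosterLoss γ (w (Fin.castLE i.isLt.le j)) y₀)
      = fun j => boosterLoss γ (w' (Fin.castLE i.isLt.le j)) y₀ := by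
    funext j
    rw [h _ (Fin.lt_def.2 (by simp))]
  rw [this]

/-- Truncation is an odd function. -/
theorem clip_mul_sign (z : ℝ) (y₀ : ℤˣ) :
    clip z * ((y₀ : ℤ) : ℝ) = clip (z * ((y₀ : ℤ) : ℝ)) := by
  rcases units_int_cast_eq_or y₀ with h | h <;> rw [h]
  · simp
  · unfold clip
    rcases le_total 1 z with h1 | h1 <;> rcases le_total (-1) z with h2 | h2 <;>
      simp only [max_def, min_def] <;> split_ifs <;> linarith

theorem oco_round {N : ℕ} (hN : 1 ≤ N) {γ : ℝ} {A : OCOAlgorithm unitInterval} {RA : ℝ}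
    (hA : IsOCORegretBound A half (boosterLosses γ) N RA) (w : Fin N → ℤˣ) (y₀ : ℤˣ) :
    ∑ i, (passProb γ A w y₀ i : ℝ) * (1 / γ * ((w i : ℤ) : ℝ) * ((y₀ : ℤ) : ℝ) - 1) - RA ≤
      N * (clip (1 / (γ * N) * ∑ i, ((w i : ℤ) : ℝ)) * ((y₀ : ℤ) : ℝ) - 1) := by
  have hN' : (0 : ℝ) < N := by exact_mod_cast hN
  have h := hA (fun j => boosterLoss γ (w j) y₀) fun j => ⟨w j, y₀, rfl⟩
  rw [clip_mul_sign]
  set z := 1 / (γ * N) * ∑ i, ((w i : ℤ) : ℝ) * ((y₀ : ℤ) : ℝ) with hz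
  have hz' : 1 / (γ * N) * (∑ i, ((w i : ℤ) : ℝ)) * ((y₀ : ℤ) : ℝ) = z := by
    rw [hz, ← Finset.sum_mul, mul_assoc]
  rw [hz']
  have hsum : ∀ p : unitInterval, ∑ i, boosterLoss γ (w i) y₀ p = p * (N * (z - 1)) := by
    intro p
    simp only [boosterLoss]
    rw [← Finset.mul_sum, Finset.sum_sub_distrib]
    congr 1
    have : (N : ℝ) * z = ∑ i, 1 / γ * ((w i : ℤ) : ℝ) * ((y₀ : ℤ) : ℝ) := by
      simp_rw [mul_assoc]
      rw [hz, ← Finset.mul_sum, ← mul_assoc (N : ℝ)]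
      congr 1
      field_simp
    rw [← this]
    simp
    ring
  -- The real infimum is meaningful only for a set bounded below.
  have hbdd : BddBelow (Set.range fun p : unitInterval => ∑ i, boosterLoss γ (w i) y₀ p) := by
    refine ⟨-|N * (z - 1)|, ?_⟩
    rintro _ ⟨p, rfl⟩
    simp only [hsum]
    have := neg_abs_le (p * (N * (z - 1)) : ℝ)
    rw [abs_mul, abs_of_nonneg p.2.1] at this
    nlinarith [abs_nonneg (N * (z - 1)), p.2.2, p.2.1]
  have h0 := ciInf_le hbdd 0
  have h1 := ciInf_le hbdd 1
  simp only [hsum] at h0 h1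
  simp only [Set.Icc.coe_zero, Set.Icc.coe_one, zero_mul, one_mul] at h0 h1
  simp only [ocoRegret, hsum] at h
  have hplay : ∑ i, boosterLoss γ (w i) y₀ (ocoPlay A half (fun j => boosterLoss γ (w j) y₀) i)
      = ∑ i, (passProb γ A w y₀ i : ℝ) * (1 / γ * ((w i : ℤ) : ℝ) * ((y₀ : ℤ) : ℝ) - 1) := rfl
  rw [hplay] at h
  unfold clip
  -- If `1 ≤ z`, the right side is `0` and the comparator `p = 0` suffices; otherwise `p = 1` does,
  -- as truncation from below only increases `z`.
  rcases le_total 1 z with hz1 | hz1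
  · rw [min_eq_left hz1, max_eq_right (by norm_num)]
    linarith
  · rw [min_eq_right hz1]
    have : (N : ℝ) * (z - 1) ≤ N * (max (-1) z - 1) := by
      gcongr
      exact le_max_right _ _
    linarith

/-! ### The run of the booster -/

variable {N : ℕ} (W : Fin N → OnlineLearner X) (γ : ℝ)
  (A : OCOAlgorithm unitInterval) (x : ℕ → X) (y : ℕ → ℤˣ)

/-- In round `t`, the example is passed to the `i`-th weak learner. -/
abbrev boosterPass (ω : BoosterSpace W) (t : ℕ) (i : Fin N) : Prop :=
  ω.2.1 t i < passProb γ A (boosterWeak W γ A x y ω t) (y t) i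

theorem boosterState_succ (ω : BoosterSpace W) (t : ℕ) (i : Fin N) :
    boosterState W γ A x y ω (t + 1) i =
      if boosterPass W γ A x y ω t i
      then (W i).update (boosterState W γ A x y ω t i) (x t) (y t) ((ω.1 i).2 t)
      else boosterState W γ A x y ω t i := rfl

instance : IsProbabilityMeasure (boosterLaw W) := by
  unfold boosterLaw
  infer_instance

theorem measurable_noise (i : Fin N) (t : ℕ) :
    Measurable fun ω : BoosterSpace W => (ω.1 i).2 t :=
  (measurable_pi_apply t).comp
    (measurable_snd.comp ((measurable_pi_apply i).comp measurable_fst))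

theorem measurable_boosterWeak_of_state (t : ℕ)
    (h : ∀ i, Measurable fun ω => boosterState W γ A x y ω t i) :
    Measurable fun ω => boosterWeak W γ A x y ω t :=
  measurable_pi_lambda _ fun i =>
    ((W i).measurable_predict (x t)).comp ((h i).prodMk (measurable_noise W i t))

theorem measurableSet_boosterPass_of_weak (t : ℕ) (i : Fin N)
    (h : Measurable fun ω => boosterWeak W γ A x y ω t) :
    MeasurableSet {ω | boosterPass W γ A x y ω t i} :=
  measurableSet_lt
    ((measurable_pi_apply i).comp ((measurable_pi_apply t).comp
      (measurable_fst.comp measurable_snd)))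
    -- `A` is arbitrary, but its decision is a function of `w`, which ranges over a discrete space.
    ((Measurable.of_discrete (f := fun w => passProb γ A w (y t) i)).comp h)

theorem measurable_boosterState (t : ℕ) (i : Fin N) :
    Measurable fun ω => boosterState W γ A x y ω t i := by
  induction t generalizing i with
  | zero => exact measurable_fst.comp ((measurable_pi_apply i).comp measurable_fst)
  | succ t ih =>
    simp_rw [boosterState_succ]
    exact Measurable.ite
      (measurableSet_boosterPass_of_weak W γ A x y t i
        (measurable_boosterWeak_of_state W γ A x y t ih))
      (((W i).measurable_update (x t) (y t)).comp ((ih i).prodMk (measurable_noise W i t))) (ih i)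

theorem measurable_boosterWeak (t : ℕ) : Measurable fun ω => boosterWeak W γ A x y ω t :=
  measurable_boosterWeak_of_state W γ A x y t (measurable_boosterState W γ A x y t)

theorem measurableSet_boosterPass (t : ℕ) (i : Fin N) :
    MeasurableSet {ω | boosterPass W γ A x y ω t i} :=
  measurableSet_boosterPass_of_weak W γ A x y t i (measurable_boosterWeak W γ A x y t)

theorem integrable_boosterWeak (t : ℕ) (f : (Fin N → ℤˣ) → ℝ) :
    Integrable (fun ω => f (boosterWeak W γ A x y ω t)) (boosterLaw W) :=
  integrable_comp_of_finite (measurable_boosterWeak W γ A x y t) f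

theorem integrable_ite_boosterPass (t : ℕ) (i : Fin N) (f : (Fin N → ℤˣ) → ℝ) :
    Integrable (fun ω => if boosterPass W γ A x y ω t i then f (boosterWeak W γ A x y ω t) else 0)
      (boosterLaw W) := by
  refine ((integrable_boosterWeak W γ A x y t f).indicator
    (measurableSet_boosterPass W γ A x y t i)).congr (.of_forall fun ω => ?_)
  simp [Set.indicator_apply]

/-! ### The passed examples do not depend on the tape of the weak learner -/

theorem measurePreserving_resample_tape (i : Fin N) :
    MeasurePreserving
      (fun p : BoosterSpace W × (W i).Tape => ((Function.update p.1.1 i p.2, p.1.2) :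
        BoosterSpace W))
      ((boosterLaw W).prod (W i).tapeLaw) (boosterLaw W) := by
  have := measurePreserving_update (fun i => (W i).tapeLaw) i
  rw [Measure.infinitePi_eq_pi] at this
  exact measurePreserving_resample_fst this

/-- Information flows only from lower to higher indices: learner `j` is influenced by the tapes of
learners `k ≤ j` alone. -/
theorem boosterState_update_tape (ω : BoosterSpace W) (i : Fin N) (τ : (W i).Tape) (t : ℕ)
    {j : Fin N} (hj : j < i) :
    boosterState W γ A x y (Function.update ω.1 i τ, ω.2) t j = boosterState W γ A x y ω t j := by
  induction t generalizing j with
  | zero => simp [boosterState, Function.update_of_ne hj.ne]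
  | succ t ih =>
    have hpass : passProb γ A (boosterWeak W γ A x y (Function.update ω.1 i τ, ω.2) t) (y t) j
        = passProb γ A (boosterWeak W γ A x y ω t) (y t) j := by
      refine passProb_congr γ A (y t) fun k hk => ?_
      simp [boosterWeak, weakPredictions, ih (hk.trans hj), Function.update_of_ne (hk.trans hj).ne]
    simp only [boosterState_succ, boosterPass, hpass, ih hj, Function.update_of_ne hj.ne]

/-- Unlike the state, the passing decision is unaffected even at index `i` itself, since it uses
only predictions with index `< i`. -/
theorem boosterPass_update_tape (ω : BoosterSpace W) (i : Fin N) (τ : (W i).Tape) (t : ℕ) :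
    boosterPass W γ A x y (Function.update ω.1 i τ, ω.2) t i ↔ boosterPass W γ A x y ω t i := by
  have hpass : passProb γ A (boosterWeak W γ A x y (Function.update ω.1 i τ, ω.2) t) (y t) i
      = passProb γ A (boosterWeak W γ A x y ω t) (y t) i := by
    refine passProb_congr γ A (y t) fun k hk => ?_
    simp [boosterWeak, weakPredictions, boosterState_update_tape W γ A x y ω i τ t hk,
      Function.update_of_ne hk.ne]
  simp only [boosterPass, hpass]

theorem boosterState_eq_lazyState (ω : BoosterSpace W) (i : Fin N) (τ : (W i).Tape)
    (b : ℕ → Prop) [DecidablePred b] (t : ℕ) (hb : ∀ s < t, b s ↔ boosterPass W γ A x y ω s i) :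
    boosterState W γ A x y (Function.update ω.1 i τ, ω.2) t i = (W i).lazyState x y b τ t := by
  induction t with
  | zero => simp [boosterState, OnlineLearner.lazyState]
  | succ t ih =>
    have ih := ih fun s hs => hb s (hs.trans t.lt_succ_self)
    rw [boosterState_succ, OnlineLearner.lazyState, ih]
    simp only [boosterPass_update_tape, hb t t.lt_succ_self, Function.update_self]

/-- On the examples passed to it, each weak learner has its guaranteed gain in expectation. -/
theorem passed_gain {H : Set (X → ℤˣ)} {T : ℕ} {R : ℕ → ℝ} (i : Fin N)
    (hW : IsWeakOnlineLearner H γ T R (W i)) (hxy : Realizable H T x y) :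
    -R T ≤ ∑ t ∈ Finset.range T, ∫ ω, (if boosterPass W γ A x y ω t i then
      ((boosterWeak W γ A x y ω t i : ℤ) : ℝ) * ((y t : ℤ) : ℝ) - γ else 0) ∂boosterLaw W := by
  have hint : ∀ t ∈ Finset.range T, Integrable (fun ω => if boosterPass W γ A x y ω t i then
      ((boosterWeak W γ A x y ω t i : ℤ) : ℝ) * ((y t : ℤ) : ℝ) - γ else 0) (boosterLaw W) :=
    fun t _ => integrable_ite_boosterPass W γ A x y t i
      fun w => ((w i : ℤ) : ℝ) * ((y t : ℤ) : ℝ) - γ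
  rw [← integral_finsetSum _ hint]
  -- After resampling the tape of learner `i`, the bound holds for every fixed `ω`, with the
  -- expectation over the fresh tape only.
  obtain ⟨h1, h2⟩ := integral_resample (measurePreserving_resample_tape W i)
    (integrable_finsetSum _ hint)
  rw [h2]
  have hconst : -R T = ∫ _, -R T ∂boosterLaw W := by simp
  rw [hconst]
  refine integral_mono (integrable_const _) h1 fun ω => ?_
  classical
  -- Adding all rounds from `T` on makes `b` infinite and changes nothing within the horizon.
  let b : ℕ → Prop := fun t => boosterPass W γ A x y ω t i ∨ T ≤ t
  have hb : ∀ t < T, b t ↔ boosterPass W γ A x y ω t i := fun t ht => by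
    simp [b, not_le.2 ht]
  have hinf : (Set.ofPred b).Infinite := (Set.Ici_infinite T).mono fun t ht => Or.inr ht
  refine (hW.lazy_gain hxy b hinf).trans_eq (integral_congr_ae (.of_forall fun τ => ?_))
  refine Finset.sum_congr rfl fun t ht => ?_
  have ht := Finset.mem_range.1 ht
  have hs := boosterState_eq_lazyState W γ A x y ω i τ b t fun s hs => hb s (hs.trans ht)
  simp only [boosterPass_update_tape, hb t ht, boosterWeak, weakPredictions, hs,
    Function.update_self]

/-! ### The passing probabilities -/

theorem measurePreserving_resample_row (t : ℕ) :
    MeasurePreserving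
      (fun p : BoosterSpace W × (Fin N → unitInterval) =>
        ((p.1.1, Function.update p.1.2.1 t p.2, p.1.2.2) : BoosterSpace W))
      ((boosterLaw W).prod (Measure.pi fun _ => volume)) (boosterLaw W) :=
  measurePreserving_resample_snd (measurePreserving_resample_fst
    (measurePreserving_update (fun _ : ℕ => Measure.pi fun _ : Fin N =>
      (volume : Measure unitInterval)) t))

/-- Neither the passing coins of round `t` or later nor any projection seed enters this state, so
those may be resampled. -/
theorem boosterState_congr {ω ω' : BoosterSpace W} (t : ℕ) (h₁ : ω.1 = ω'.1)
    (h₂ : ∀ s < t, ω.2.1 s = ω'.2.1 s) :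
    boosterState W γ A x y ω t = boosterState W γ A x y ω' t := by
  induction t with
  | zero => simp [boosterState, h₁]
  | succ t ih =>
    have ih := ih fun s hs => h₂ s (hs.trans t.lt_succ_self)
    simp only [boosterState, ih, h₁, h₂ t t.lt_succ_self]

theorem boosterWeak_congr {ω ω' : BoosterSpace W} (t : ℕ) (h₁ : ω.1 = ω'.1)
    (h₂ : ∀ s < t, ω.2.1 s = ω'.2.1 s) :
    boosterWeak W γ A x y ω t = boosterWeak W γ A x y ω' t := by
  simp only [boosterWeak, boosterState_congr W γ A x y t h₁ h₂, h₁]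

/-- The weak predictions of round `t` are determined before its coins are tossed; integrating out
the fresh coin leaves the probability of passing. -/
theorem integral_ite_boosterPass (t : ℕ) (i : Fin N) (f : (Fin N → ℤˣ) → ℝ) :
    ∫ ω, (if boosterPass W γ A x y ω t i then f (boosterWeak W γ A x y ω t) else 0) ∂boosterLaw W
      = ∫ ω, (passProb γ A (boosterWeak W γ A x y ω t) (y t) i : ℝ) *
          f (boosterWeak W γ A x y ω t) ∂boosterLaw W := by
  rw [(integral_resample (measurePreserving_resample_row W t)
    (integrable_ite_boosterPass W γ A x y t i f)).2]
  refine integral_congr_ae (.of_forall fun ω => ?_)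
  have : ∀ r, boosterWeak W γ A x y (ω.1, Function.update ω.2.1 t r, ω.2.2) t
      = boosterWeak W γ A x y ω t := fun r =>
    boosterWeak_congr W γ A x y t rfl fun s hs => by simp [Function.update_of_ne hs.ne]
  simp only [boosterPass, this, Function.update_self]
  exact integral_pi_unitInterval_ite i _ _

/-! ### The randomized projection -/

theorem measurePreserving_resample_proj (t : ℕ) :
    MeasurePreserving
      (fun p : BoosterSpace W × unitInterval =>
        ((p.1.1, p.1.2.1, Function.update p.1.2.2 t p.2) : BoosterSpace W))
      ((boosterLaw W).prod volume) (boosterLaw W) :=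
  measurePreserving_resample_snd (measurePreserving_resample_snd
    (measurePreserving_update (fun _ : ℕ => (volume : Measure unitInterval)) t))

theorem measurable_boosterPrediction (t : ℕ) :
    Measurable fun ω => boosterPrediction W γ A x y ω t := by
  refine measurable_randomProj.comp (Measurable.prodMk ?_ ?_)
  · exact (Measurable.of_discrete
      (f := fun w : Fin N → ℤˣ => 1 / (γ * N) * ∑ i, ((w i : ℤ) : ℝ))).comp
      (measurable_boosterWeak W γ A x y t)
  · exact (measurable_pi_apply t).comp (measurable_snd.comp measurable_snd)

theorem integral_boosterPrediction (t : ℕ) (c : ℝ) :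
    ∫ ω, ((boosterPrediction W γ A x y ω t : ℤ) : ℝ) * c ∂boosterLaw W
      = ∫ ω, clip (1 / (γ * N) * ∑ i, ((boosterWeak W γ A x y ω t i : ℤ) : ℝ)) * c
          ∂boosterLaw W := by
  rw [(integral_resample (measurePreserving_resample_proj W t)
    (integrable_comp_of_finite (measurable_boosterPrediction W γ A x y t)
      fun a : ℤˣ => ((a : ℤ) : ℝ) * c)).2]
  refine integral_congr_ae (.of_forall fun ω => ?_)
  have : ∀ v, boosterWeak W γ A x y (ω.1, ω.2.1, Function.update ω.2.2 t v) t
      = boosterWeak W γ A x y ω t := fun v => boosterWeak_congr W γ A x y t rfl fun _ _ => rfl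
  simp only [boosterPrediction, this, Function.update_self, integral_mul_const,
    integral_randomProj]

/-- The expected gain of the booster. -/
theorem booster_gain {H : Set (X → ℤˣ)} {T : ℕ} {R : ℕ → ℝ} {RA : ℝ} (hγ : 0 < γ) (hN : 1 ≤ N)
    (hW : ∀ i, IsWeakOnlineLearner H γ T R (W i))
    (hA : IsOCORegretBound A half (boosterLosses γ) N RA) (hxy : Realizable H T x y) :
    T - (R T / γ + T * (RA / N)) ≤ ∑ t ∈ Finset.range T,
      ∫ ω, ((boosterPrediction W γ A x y ω t : ℤ) : ℝ) * ((y t : ℤ) : ℝ) ∂boosterLaw W := by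
  have hN' : (0 : ℝ) < N := by exact_mod_cast hN
  set G : ℕ → Fin N → ℝ := fun t i => ∫ ω,
    (passProb γ A (boosterWeak W γ A x y ω t) (y t) i : ℝ) *
      (((boosterWeak W γ A x y ω t i : ℤ) : ℝ) * ((y t : ℤ) : ℝ) - γ) ∂boosterLaw W with hG
  have hGi : ∀ i, -R T ≤ ∑ t ∈ Finset.range T, G t i := fun i => by
    refine (passed_gain W γ A x y i (hW i) hxy).trans_eq (Finset.sum_congr rfl fun t _ => ?_)
    exact integral_ite_boosterPass W γ A x y t i
      fun w => ((w i : ℤ) : ℝ) * ((y t : ℤ) : ℝ) - γ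
  have hround : ∀ t, 1 + (1 / γ * ∑ i, G t i - RA) / N ≤
      ∫ ω, ((boosterPrediction W γ A x y ω t : ℤ) : ℝ) * ((y t : ℤ) : ℝ) ∂boosterLaw W := by
    intro t
    rw [integral_boosterPrediction]
    have hint : ∀ i ∈ Finset.univ, Integrable (fun ω =>
        (passProb γ A (boosterWeak W γ A x y ω t) (y t) i : ℝ) *
          (((boosterWeak W γ A x y ω t i : ℤ) : ℝ) * ((y t : ℤ) : ℝ) - γ)) (boosterLaw W) :=
      fun i _ => integrable_boosterWeak W γ A x y t fun w =>
        (passProb γ A w (y t) i : ℝ) * (((w i : ℤ) : ℝ) * ((y t : ℤ) : ℝ) - γ)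
    have hsum : Integrable (fun ω => 1 / γ * ∑ i,
        (passProb γ A (boosterWeak W γ A x y ω t) (y t) i : ℝ) *
          (((boosterWeak W γ A x y ω t i : ℤ) : ℝ) * ((y t : ℤ) : ℝ) - γ)) (boosterLaw W) :=
      (integrable_finsetSum _ hint).const_mul _
    have hlhs : 1 + (1 / γ * ∑ i, G t i - RA) / N = ∫ ω, (1 + (1 / γ * ∑ i,
        (passProb γ A (boosterWeak W γ A x y ω t) (y t) i : ℝ) *
          (((boosterWeak W γ A x y ω t i : ℤ) : ℝ) * ((y t : ℤ) : ℝ) - γ) - RA) / N)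
          ∂boosterLaw W := by
      have hsub : Integrable (fun ω => (1 / γ * ∑ i,
          (passProb γ A (boosterWeak W γ A x y ω t) (y t) i : ℝ) *
            (((boosterWeak W γ A x y ω t i : ℤ) : ℝ) * ((y t : ℤ) : ℝ) - γ) - RA) / N)
          (boosterLaw W) := (hsum.sub (integrable_const _)).div_const _
      rw [integral_add (integrable_const _) hsub,
        integral_div, integral_sub hsum (integrable_const _), integral_const_mul,
        integral_finsetSum _ hint]
      simp [hG]
    rw [hlhs]
    refine integral_mono
      ((integrable_const _).add ((hsum.sub (integrable_const _)).div_const _))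
      (integrable_boosterWeak W γ A x y t fun w =>
        clip (1 / (γ * N) * ∑ i, ((w i : ℤ) : ℝ)) * ((y t : ℤ) : ℝ)) fun ω => ?_
    have h := oco_round hN hA (boosterWeak W γ A x y ω t) (y t)
    have hrw : 1 / γ * ∑ i, (passProb γ A (boosterWeak W γ A x y ω t) (y t) i : ℝ) *
          (((boosterWeak W γ A x y ω t i : ℤ) : ℝ) * ((y t : ℤ) : ℝ) - γ)
        = ∑ i, (passProb γ A (boosterWeak W γ A x y ω t) (y t) i : ℝ) *
          (1 / γ * ((boosterWeak W γ A x y ω t i : ℤ) : ℝ) * ((y t : ℤ) : ℝ) - 1) := by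
      rw [Finset.mul_sum]
      refine Finset.sum_congr rfl fun i _ => ?_
      field_simp
    simp only [hrw]
    rw [← le_sub_iff_add_le', div_le_iff₀' hN']
    exact h
  refine le_trans ?_ (Finset.sum_le_sum fun t _ => hround t)
  -- The optimizer's bound sums over learners within a round, the learners' bounds over rounds;
  -- exchanging the sums joins them.
  have hall : -(N * R T) ≤ ∑ t ∈ Finset.range T, ∑ i, G t i := by
    rw [Finset.sum_comm]
    have := Finset.sum_le_sum fun i (_ : i ∈ Finset.univ) => hGi i
    simpa using this
  have hrw : ∑ t ∈ Finset.range T, (1 + (1 / γ * ∑ i, G t i - RA) / N)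
      = T - T * (RA / N) + (1 / (γ * N)) * ∑ t ∈ Finset.range T, ∑ i, G t i := by
    rw [Finset.mul_sum, Finset.sum_congr rfl fun t _ => show
      1 + (1 / γ * ∑ i, G t i - RA) / N = (1 - RA / N) + 1 / (γ * N) * ∑ i, G t i by
        field_simp; ring, Finset.sum_add_distrib]
    simp only [Finset.sum_const, Finset.card_range, nsmul_eq_mul]
    ring
  rw [hrw]
  have := mul_le_mul_of_nonneg_left hall (by positivity : 0 ≤ 1 / (γ * N))
  have h2 : 1 / (γ * N) * -(N * R T) = -(R T / γ) := by field_simp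
  linarith

end OnlineBoosting

theorem theorem6 :
    ∃ g : ℕ → ℝ, (∀ T, 0 ≤ g T) ∧ OnlineBoosting.IsSoftOSqrt g ∧
      ∀ (X : Type u) (H : Set (X → ℤˣ)) (γ : ℝ) (T N : ℕ) (RW : ℕ → ℝ) (RA : ℝ)
        (W : Fin N → OnlineBoosting.OnlineLearner.{u, v, w} X)
        (A : OnlineBoosting.OCOAlgorithm unitInterval)
        (x : ℕ → X) (y : ℕ → ℤˣ),
        0 < γ → 1 ≤ T → 1 ≤ N →
        (∀ i, OnlineBoosting.IsWeakOnlineLearner H γ T RW (W i)) →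
        OnlineBoosting.IsOCORegretBound A OnlineBoosting.half
          (OnlineBoosting.boosterLosses γ) N RA →
        OnlineBoosting.Realizable H T x y →
        1 - ((2 * RW T + g T) / (γ * T) + RA / N) ≤
          1 / (T : ℝ) * ∑ t ∈ Finset.range T,
            ∫ ω, ((OnlineBoosting.boosterPrediction W γ A x y ω t : ℤ) : ℝ) * ((y t : ℤ) : ℝ)
              ∂OnlineBoosting.boosterLaw W := by
  -- Passing decisions are independent of the receiving learner, so no concentration term arises.
  refine ⟨fun _ => 0, fun _ => le_rfl, ⟨0, Asymptotics.isBigO_zero _ _⟩, ?_⟩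
  intro X H γ T N RW RA W A x y hγ hT hN hW hA hxy
  have hT' : (0 : ℝ) < T := by exact_mod_cast hT
  -- The argument yields `RW T`; nonnegativity, available because at least one learner exists,
  -- weakens it to `2 * RW T`.
  have hR : 0 ≤ RW T := (hW ⟨0, hN⟩).regret.nonneg T
  have h := OnlineBoosting.booster_gain W γ A x y hγ hN hW hA hxy
  refine le_trans ?_ (mul_le_mul_of_nonneg_left h (by positivity : 0 ≤ 1 / (T : ℝ)))
  have h1 : 1 / (T : ℝ) * (T - (RW T / γ + T * (RA / N))) = 1 - (RW T / (γ * T) + RA / N) := by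
    field_simp
  rw [h1]
  gcongr
  linarith
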